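/- Fix an integer $m\ge 1$, a link rate $W>0$ (bits per second) and a guard parameter $\Delta\ge 0$. For each $n$, let the positions $X_1,\dots,X_n$ of $n$ nodes be independent and uniformly distributed in the unit square, and let every node $i$ be the source of one multicast session whose set $D_i$ of $m$ destinations is uniformly distributed among the $m$-element sets of other nodes, independently over $i$ and of the positions (this requires $n>m$). All nodes use the same communication range $T(n)>0$. Nodes have multi-packet transmission (MPT) and multi-packet reception (MPR) and work in half-duplex, store-and-forward mode, without network coding. That is, a scheme (which may depend on the positions and the destination sets) is a set of one-hop transmissions of single bits, each starting at a time $\ge 0$ and lasting $1/W$ seconds, such that: sender and receiver of a transmission are at distance at most $T(n)$; while a node $X_j$ receives, every transmitting node $X_k$ satisfies $|X_k-X_j|\le T(n)$ or $|X_k-X_j|\ge(1+\Delta)T(n)$; no node transmits and receives at the same time; each ordered pair of nodes carries at most one bit at a time (but a node may use any number of such links simultaneously as transmitter, or as receiver); and a node transmits only bits of its own session or bits that it has completely received before. A bit of a session is delivered once all $m$ destinations of the session have received it. A throughput of $\lambda$ bits per second for each node is feasible if there are a scheme and a period $\tau\in(0,\infty)$ such that, for every $r=1,2,\dots$ and every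 source, the delivery of at least $\lambda\tau$ bits of that source is completed during the time interval $[(r-1)\tau,r\tau]$ (more precisely, these bits are delivered by time $r\tau$ but not by time $(r-1)\tau$). Then the per-node multicast throughput capacity is $C_m(n)=O\left(nT^3(n)\right)$ with high probability. That is, there is a constant $c>0$, depending only on $m$, $W$ and $\Delta$, such that for every choice of ranges $T(n)>0$, $$\lim_{n\to\infty}\mathrm{Prob}\left(\text{a throughput of } c\,nT^3(n) \text{ for each node is feasible}\right)=0.$$ -/

import Mathlib

open MeasureTheory ProbabilityTheory Filter Topology

namespace Multicast

/-- The plane with its Euclidean distance. -/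
abbrev Plane : Type := EuclideanSpace ℝ (Fin 2)

/-- The network area `[0, 1] × [0, 1]`. -/
def unitSquare : Set Plane := {x | ∀ k, x k ∈ Set.Icc (0 : ℝ) 1}

/-- All multicast assignments on `n` nodes: node `i` is the source of one session and `D i` is its
set of destinations, which are `m` distinct nodes other than `i`. -/
def assignments (n m : ℕ) : Set (Fin n → Finset (Fin n)) :=
  {D | ∀ i, (D i).card = m ∧ i ∉ D i}

/-- The law of the random network: the `n` positions are independent and uniform in the unit square,
and, independently of the positions, the destination sets are independent and uniform (a uniformly
random element of the product set `assignments n m`). It is a probability measure for `m < n`. -/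
noncomputable def networkLaw (n m : ℕ) :
    Measure ((Fin n → Plane) × (Fin n → Finset (Fin n))) :=
  (Measure.pi fun _ : Fin n => (volume : Measure Plane).restrict unitSquare).prod
    (uniformOn (assignments n m))

/-- One hop of one bit: `sender` transmits to `receiver`, from time `start` on, the bit number
`index` of the session whose source is `source`. -/
structure Hop (n : ℕ) where
  sender : Fin n
  receiver : Fin n
  source : Fin n
  index : ℕ
  start : ℝ

/-- The time at which a hop ends, when a link carries `W` bits per second. -/
noncomputable def Hop.finish {n : ℕ} (W : ℝ) (p : Hop n) : ℝ := p.start + 1 / W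

/-- Two hops are simultaneous when the time intervals `[start, finish)` that they occupy meet. -/
def Hop.Simultaneous {n : ℕ} (W : ℝ) (p q : Hop n) : Prop :=
  p.start < q.finish W ∧ q.start < p.finish W

/-- A store-and-forward scheme (a set of hops, without coding) that obeys the protocol model with
multi-packet transmission and multi-packet reception. `X` are the positions of the nodes, `T` is
the common communication range, `Δ` the guard parameter, `W` the rate of a link. -/
structure IsScheme {n : ℕ} (W Δ T : ℝ) (X : Fin n → Plane) (S : Set (Hop n)) : Prop where
  /-- The network starts to operate at time `0`. -/
  start_nonneg : ∀ p ∈ S, 0 ≤ p.start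
  /-- Nodes communicate within the common range only. -/
  in_range : ∀ p ∈ S, dist (X p.sender) (X p.receiver) ≤ T
  /-- Interference: while a node receives, every node that transmits is either within the range
  (and then is decoded, by multi-packet reception) or outside the guard zone. -/
  guard_zone : ∀ p ∈ S, ∀ q ∈ S, p.Simultaneous W q →
    dist (X q.sender) (X p.receiver) ≤ T ∨ (1 + Δ) * T ≤ dist (X q.sender) (X p.receiver)
  /-- Half-duplex: no node transmits and receives at the same time. -/
  half_duplex : ∀ p ∈ S, ∀ q ∈ S, p.Simultaneous W q → p.sender ≠ q.receiver
  /-- Each ordered pair of nodes carries at most one bit at a time. There is no bound on the number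
  of links that a node uses simultaneously as a transmitter, or as a receiver. -/
  link_rate : ∀ p ∈ S, ∀ q ∈ S, p.sender = q.sender → p.receiver = q.receiver →
    p.Simultaneous W q → p = q
  /-- A node transmits only bits of its own session and bits that it has received and buffered. -/
  causal : ∀ p ∈ S, p.source = p.sender ∨
    ∃ q ∈ S, q.receiver = p.sender ∧ q.source = p.source ∧ q.index = p.index ∧
      q.finish W ≤ p.start

/-- By time `t`, every destination of source `i` has received the bit number `k` of `i`. -/
def Delivered {n : ℕ} (W : ℝ) (D : Fin n → Finset (Fin n)) (S : Set (Hop n)) (i : Fin n) (k : ℕ)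
    (t : ℝ) : Prop :=
  ∀ d ∈ D i, ∃ p ∈ S, p.receiver = d ∧ p.source = i ∧ p.index = k ∧ p.finish W ≤ t

/-- A throughput of `rate` bits per second for each node is feasible: under some scheme there is a
period `τ` such that in every time interval `[r τ, (r + 1) τ]` each node completes the delivery
of at least `rate * τ` bits to all its destinations. -/
def Feasible {n : ℕ} (W Δ T : ℝ) (X : Fin n → Plane) (D : Fin n → Finset (Fin n))
    (rate : ℝ) : Prop :=
  ∃ S : Set (Hop n), IsScheme W Δ T X S ∧ ∃ τ : ℝ, 0 < τ ∧ ∀ r : ℕ, ∀ i : Fin n,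
    ∃ B : Finset ℕ, rate * τ ≤ (B.card : ℝ) ∧
      ∀ k ∈ B, Delivered W D S i k ((r + 1) * τ) ∧ ¬ Delivered W D S i k (r * τ)

/-- The probability that a throughput of `rate` for each node is feasible in the random network with
`n` nodes and `m` destinations for each source. -/
noncomputable def feasibleProb (n m : ℕ) (W Δ T rate : ℝ) : ENNReal :=
  networkLaw n m {ω | Feasible W Δ T ω.1 ω.2 rate}

end Multicast

namespace Multicast

/-! This is a transport capacity argument. Choose one destination `f i` of each source `i`, and let
L be the number of ordered pairs in range. If throughput λ is feasible, at least λτ bits per source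
reach `f i` during the first period. A bit that travels a distance d needs at least d/T hops, no hop
serves two bits, and all links together carry at most WτL hops. Hence λ ∑ |X_i - X_{f i}| ≤ W T L
(`Feasible.rate_mul_sum_dist_le`). Outside an event of probability at most 2^(-n), at least half of
the nodes are farther than 1/32 from their partner (`pi_half_lt_card_closeTo_le`), so the sum is at
least n/64, and λ = 512 W n T³ forces L ≥ 8n²T².

A disc of radius T has mass at most p = 4T², so L has mean at most n²p, and 8n²T² is twice that.
Chebyshev makes this unlikely if n²p is large (`pi_two_mul_le_card_links_le`). For small T
concentration fails, but every source must transmit, so L ≥ n (`Feasible.le_card_links`), which has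
probability at most np by Markov (`pi_le_card_links_le`). Splitting at np = 1/√n gives a bound
uniform in T. -/

open scoped Classical in
/-- The ordered pairs of distinct nodes that are within the communication range. -/
noncomputable def links {n : ℕ} (T : ℝ) (X : Fin n → Plane) : Finset (Fin n × Fin n) :=
  Finset.univ.filter fun e => e.1 ≠ e.2 ∧ dist (X e.1) (X e.2) ≤ T

lemma mem_links {n : ℕ} {T : ℝ} {X : Fin n → Plane} {e : Fin n × Fin n} :
    e ∈ links T X ↔ e.1 ≠ e.2 ∧ dist (X e.1) (X e.2) ≤ T := by
  simp [links]

/-! ### Routes of bits and capacity of links, for fixed positions -/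

section Scheme

variable {n : ℕ} {W Δ T : ℝ} {X : Fin n → Plane} {S : Set (Hop n)}

lemma Hop.start_lt_finish (hW : 0 < W) (p : Hop n) : p.start < p.finish W := by
  have : 0 < 1 / W := by positivity
  unfold Hop.finish
  linarith

lemma IsScheme.mem_links (hS : IsScheme W Δ T X S) (hW : 0 < W) {p : Hop n} (hp : p ∈ S) :
    (p.sender, p.receiver) ∈ links T X :=
  -- A hop is simultaneous with itself, so half-duplex excludes self-loops.
  Multicast.mem_links.2 ⟨hS.half_duplex p hp p hp ⟨p.start_lt_finish hW, p.start_lt_finish hW⟩,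
    hS.in_range p hp⟩

/-- The bit that a hop carries has left its source through some hop. -/
lemma IsScheme.exists_sender_eq_source (hS : IsScheme W Δ T X S) (hW : 0 < W) (N : ℕ) :
    ∀ p ∈ S, W * p.start < N → ∃ q ∈ S, q.sender = p.source := by
  -- N bounds the start in units of 1/W. A hop that supplies the bit finishes before `p` starts,
  -- hence starts at least one unit earlier; starts are nonnegative, so tracing back ends at the
  -- source.
  induction N with
  | zero =>
    intro p hp h
    have := mul_nonneg hW.le (hS.start_nonneg p hp)
    simp only [Nat.cast_zero] at h
    linarith
  | succ N ih =>
    intro p hp h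
    rcases hS.causal p hp with h0 | ⟨q, hq, -, hs, -, hf⟩
    · exact ⟨p, hp, h0.symm⟩
    · rw [← hs]
      refine ih q hq ?_
      have := mul_le_mul_of_nonneg_left hf hW.le
      rw [Hop.finish, mul_add, mul_one_div_cancel hW.ne'] at this
      push_cast at h
      linarith

/-- The hops that brought a bit to the receiver of `p` are at least as many as the distance from
the source requires. -/
lemma IsScheme.exists_route (hS : IsScheme W Δ T X S) (hW : 0 < W) (N : ℕ) :
    ∀ p ∈ S, W * p.start < N → ∃ F : Finset (Hop n), ↑F ⊆ S ∧
      (∀ q ∈ F, q.source = p.source ∧ q.index = p.index ∧ q.finish W ≤ p.finish W) ∧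
      dist (X p.source) (X p.receiver) ≤ F.card * T := by
  classical
  induction N with
  | zero =>
    intro p hp h
    have := mul_nonneg hW.le (hS.start_nonneg p hp)
    simp only [Nat.cast_zero] at h
    linarith
  | succ N ih =>
    intro p hp h
    rcases hS.causal p hp with h0 | ⟨q, hq, hr, hs, hi, hf⟩
    · refine ⟨{p}, by simpa using hp, by simp, ?_⟩
      simpa [h0] using hS.in_range p hp
    · have hlt : W * q.start < N := by
        have := mul_le_mul_of_nonneg_left hf hW.le
        rw [Hop.finish, mul_add, mul_one_div_cancel hW.ne'] at this
        push_cast at h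
        linarith
      obtain ⟨F, hFS, hF, hd⟩ := ih q hq hlt
      -- The earlier hops all finish before `p` starts, so adding `p` really raises the count by
      -- one.
      have hpF : p ∉ F := fun hpF => by
        have := (hF p hpF).2.2
        have := p.start_lt_finish hW
        linarith
      refine ⟨insert p F, ?_, ?_, ?_⟩
      · rw [Finset.coe_insert]
        exact Set.insert_subset hp hFS
      · intro q' hq'
        rcases Finset.mem_insert.1 hq' with rfl | hq'
        · simp
        · obtain ⟨h1, h2, h3⟩ := hF q' hq'
          refine ⟨h1.trans hs, h2.trans hi, ?_⟩
          have := p.start_lt_finish hW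
          linarith
      · rw [Finset.card_insert_of_notMem hpF]
        push_cast
        have h1 := dist_triangle (X p.source) (X q.receiver) (X p.receiver)
        have h2 := hS.in_range p hp
        rw [hr] at h1 hd
        rw [hs] at hd
        linarith

/-- Every link carries at most `W * t` bits until time `t`. -/
lemma IsScheme.card_le (hS : IsScheme W Δ T X S) (hW : 0 < W) {t : ℝ} (ht : 0 ≤ t)
    (F : Finset (Hop n)) (hFS : ↑F ⊆ S) (hF : ∀ p ∈ F, p.finish W ≤ t) :
    (F.card : ℝ) ≤ (links T X).card * (W * t) := by
  have key : F.card ≤ (links T X ×ˢ Finset.range ⌊W * t⌋₊).card := by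
    -- Cut time into slots of length 1/W. Two hops of one link that start in the same slot overlap,
    -- hence coincide by `link_rate`; a hop finished by `t` starts in one of the first `⌊W * t⌋₊`
    -- slots.
    refine Finset.card_le_card_of_injOn
      (fun p => ((p.sender, p.receiver), ⌊W * p.start⌋₊)) ?_ ?_
    · intro p hp
      have h0 := mul_nonneg hW.le (hS.start_nonneg p (hFS hp))
      have := mul_le_mul_of_nonneg_left (hF p hp) hW.le
      rw [Hop.finish, mul_add, mul_one_div_cancel hW.ne'] at this
      simp only [Finset.coe_product, Set.mem_prod, Finset.mem_coe, Finset.mem_range]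
      refine ⟨hS.mem_links hW (hFS hp), ?_⟩
      rw [← Nat.add_one_le_iff, ← Nat.floor_add_one h0]
      exact Nat.floor_le_floor this
    · intro p hp q hq h
      simp only [Prod.mk.injEq] at h
      obtain ⟨⟨h1, h2⟩, h3⟩ := h
      have aux : ∀ p q : Hop n, p ∈ S → ⌊W * p.start⌋₊ = ⌊W * q.start⌋₊ →
          q.start < p.finish W := by
        intro p q hp h
        have h4 := Nat.lt_floor_add_one (W * q.start)
        have h5 := Nat.floor_le (mul_nonneg hW.le (hS.start_nonneg p hp))
        rw [← h] at h4
        have : W * q.start < W * p.finish W := by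
          rw [Hop.finish, mul_add, mul_one_div_cancel hW.ne']
          linarith
        exact lt_of_mul_lt_mul_left this hW.le
      exact hS.link_rate p (hFS hp) q (hFS hq) h1 h2
        ⟨aux q p (hFS hq) h3.symm, aux p q (hFS hp) h3⟩
  rw [Finset.card_product, Finset.card_range] at key
  calc (F.card : ℝ) ≤ ((links T X).card * ⌊W * t⌋₊ : ℕ) := by exact_mod_cast key
    _ ≤ _ := by
      push_cast
      gcongr
      exact Nat.floor_le (by positivity)

end Scheme

variable {n : ℕ} {W Δ T rate : ℝ} {X : Fin n → Plane} {D : Fin n → Finset (Fin n)}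

/-- No source is isolated when some positive throughput is feasible. -/
lemma Feasible.le_card_links (h : Feasible W Δ T X D rate) (hW : 0 < W) (hrate : 0 < rate)
    (hD : ∀ i, (D i).Nonempty) : n ≤ (links T X).card := by
  obtain ⟨S, hS, τ, hτ, hB⟩ := h
  have hne : ∀ i : Fin n, ∃ q ∈ S, q.sender = i := by
    intro i
    obtain ⟨B, hcard, hB⟩ := hB 0 i
    have hBpos : 0 < B.card := by
      have : 0 < (B.card : ℝ) := lt_of_lt_of_le (by positivity) hcard
      exact_mod_cast this
    obtain ⟨k, hk⟩ := Finset.card_pos.1 hBpos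
    obtain ⟨d, hd⟩ := hD i
    obtain ⟨p, hp, -, hsrc, -, -⟩ := (hB k hk).1 d hd
    obtain ⟨N, hN⟩ := exists_nat_gt (W * p.start)
    rw [← hsrc]
    exact hS.exists_sender_eq_source hW N p hp hN
  choose q hq hqi using hne
  calc n = (Finset.univ : Finset (Fin n)).card := by simp
    _ ≤ _ := Finset.card_le_card_of_injOn (fun i => ((q i).sender, (q i).receiver))
      (fun i _ => hS.mem_links hW (hq i)) (fun i _ j _ hij => by
        simp only [Prod.mk.injEq] at hij
        rw [← hqi i, ← hqi j, hij.1])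

/-- The transport capacity bound: the bits have to be carried over the distance between the sources
and the destinations, and every use of a link advances one bit by at most `T`. -/
lemma Feasible.rate_mul_sum_dist_le (h : Feasible W Δ T X D rate) (hW : 0 < W)
    (hT : 0 ≤ T) {f : Fin n → Fin n} (hf : ∀ i, f i ∈ D i) :
    rate * ∑ i, dist (X i) (X (f i)) ≤ W * T * (links T X).card := by
  classical
  obtain ⟨S, hS, τ, hτ, hB⟩ := h
  choose B hcard hB using hB 0
  have hroute : ∀ i k, ∃ F : Finset (Hop n), k ∈ B i → (↑F ⊆ S ∧
      (∀ q ∈ F, q.source = i ∧ q.index = k ∧ q.finish W ≤ τ) ∧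
      dist (X i) (X (f i)) ≤ F.card * T) := by
    intro i k
    by_cases hk : k ∈ B i
    · obtain ⟨p, hp, hr, hsrc, hidx, hfin⟩ := (hB i k hk).1 (f i) (hf i)
      obtain ⟨N, hN⟩ := exists_nat_gt (W * p.start)
      obtain ⟨F, hFS, hF, hd⟩ := hS.exists_route hW N p hp hN
      refine ⟨F, fun _ => ⟨hFS, fun q hq => ?_, ?_⟩⟩
      · obtain ⟨h1, h2, h3⟩ := hF q hq
        refine ⟨h1.trans hsrc, h2.trans hidx, h3.trans (hfin.trans ?_)⟩
        simp
      · rwa [hr, hsrc] at hd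
    · exact ⟨∅, fun h => absurd h hk⟩
  choose F hF using hroute
  set I : Finset (Σ _ : Fin n, ℕ) := Finset.univ.sigma B with hI
  have hmem : ∀ a ∈ I, a.2 ∈ B a.1 := fun a ha => (Finset.mem_sigma.1 ha).2
  -- Without coding a hop carries a single bit, so routes of different bits share no hop.
  have hdisj : (I : Set (Σ _ : Fin n, ℕ)).PairwiseDisjoint fun a => F a.1 a.2 := by
    intro a ha b hb hab
    refine Finset.disjoint_left.2 fun q hqa hqb => hab ?_
    obtain ⟨h1, h2, -⟩ := (hF a.1 a.2 (hmem a ha)).2.1 q hqa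
    obtain ⟨h3, h4, -⟩ := (hF b.1 b.2 (hmem b hb)).2.1 q hqb
    obtain ⟨a1, a2⟩ := a
    obtain ⟨b1, b2⟩ := b
    simp only at h1 h2 h3 h4
    subst h1 h2 h3 h4
    rfl
  have htotal := hS.card_le hW hτ.le (I.biUnion fun a => F a.1 a.2)
    (by
      intro q hq
      obtain ⟨a, ha, hq⟩ := Finset.mem_biUnion.1 (Finset.mem_coe.1 hq)
      exact (hF a.1 a.2 (hmem a ha)).1 hq)
    (by
      intro q hq
      obtain ⟨a, ha, hq⟩ := Finset.mem_biUnion.1 hq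
      exact ((hF a.1 a.2 (hmem a ha)).2.1 q hq).2.2)
  rw [Finset.card_biUnion hdisj, hI, Finset.sum_sigma] at htotal
  push_cast at htotal
  have hlow : rate * τ * ∑ i, dist (X i) (X (f i)) ≤
      (∑ i, ∑ k ∈ B i, ((F i k).card : ℝ)) * T := by
    rw [Finset.mul_sum, Finset.sum_mul]
    refine Finset.sum_le_sum fun i _ => ?_
    calc rate * τ * dist (X i) (X (f i)) ≤ (B i).card * dist (X i) (X (f i)) :=
          mul_le_mul_of_nonneg_right (hcard i) dist_nonneg
      _ = ∑ k ∈ B i, dist (X i) (X (f i)) := by simp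
      _ ≤ ∑ k ∈ B i, ((F i k).card : ℝ) * T :=
          Finset.sum_le_sum fun k hk => (hF i k hk).2.2
      _ = _ := (Finset.sum_mul _ _ _).symm
  have hup := mul_le_mul_of_nonneg_right htotal hT
  refine le_of_mul_le_mul_right ?_ hτ
  linarith

/-! ### Probability that prescribed pairs of independent points are close -/

open scoped ENNReal

lemma measurable_dist_apply {ι : Type*} (i j : ι) :
    Measurable fun X : ι → Plane => dist (X i) (X j) := by fun_prop

lemma measurableSet_dist_le {ι : Type*} (r : ℝ) (i j : ι) :
    MeasurableSet {X : ι → Plane | dist (X i) (X j) ≤ r} :=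
  measurableSet_le (measurable_dist_apply i j) measurable_const

/-- Independent points of a law for which balls of radius `r` have mass at most `q`: if `f` maps
every element of `J` to one of smaller rank, the pairs `(i, f i)` are close with probability
`q ^ #J` at most. -/
lemma pi_forall_dist_le {ι : Type*} [Fintype ι] {ν : Measure Plane} [IsProbabilityMeasure ν]
    {r : ℝ} {q : ℝ≥0∞} (hq : ∀ x, ν (Metric.closedBall x r) ≤ q) (f : ι → ι) (rank : ι → ℤ)
    (J : Finset ι) (hJ : ∀ i ∈ J, rank (f i) < rank i) :
    Measure.pi (fun _ : ι => ν) {X | ∀ i ∈ J, dist (X i) (X (f i)) ≤ r} ≤ q ^ J.card := by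
  classical
  set A : Finset ι → Set (ι → Plane) := fun J => {X | ∀ i ∈ J, dist (X i) (X (f i)) ≤ r} with hA
  have hAm : ∀ J, MeasurableSet (A J) := fun J => by
    have : A J = ⋂ i ∈ J, {X | dist (X i) (X (f i)) ≤ r} := by ext; simp [hA]
    rw [this]
    exact J.measurableSet_biInter fun i _ => measurableSet_dist_le r _ _
  set g : Finset ι → (ι → Plane) → ℝ≥0∞ := fun J => (A J).indicator 1 with hg
  have hgm : ∀ J, Measurable (g J) := fun J => measurable_one.indicator (hAm J)
  have key : ∀ J : Finset ι, (∀ i ∈ J, rank (f i) < rank i) →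
      (∫⋯∫⁻_J, g J ∂fun _ => ν) ≤ fun _ => q ^ J.card := by
    intro J
    -- Integrate out the point of largest rank first: it is the partner of no node of `J`, so with
    -- the other points frozen it only has to fall into one fixed ball, at cost `q`.
    induction J using Finset.induction_on_max_value rank with
    | empty =>
      intro _ X
      simp only [lmarginal_empty, Finset.card_empty, pow_zero]
      exact Set.indicator_le_self' (by simp) X
    | insert a s has hmax ih =>
      intro hJ
      have hlt := hJ a (Finset.mem_insert_self a s)
      have hfa : f a ≠ a := fun h => by rw [h] at hlt; exact lt_irrefl _ hlt
      rw [lmarginal_insert' _ (hgm _) has, Finset.card_insert_of_notMem has]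
      have h1 : (fun X => ∫⁻ y, g (insert a s) (Function.update X a y) ∂ν) ≤
          fun X => q * g s X := by
        intro X
        have hle : ∀ y, g (insert a s) (Function.update X a y) ≤
            (Metric.closedBall (X (f a)) r).indicator (fun _ => g s X) y := by
          intro y
          by_cases hmem : Function.update X a y ∈ A (insert a s)
          · have hy : y ∈ Metric.closedBall (X (f a)) r := by
              have := hmem a (Finset.mem_insert_self a s)
              simpa [hfa] using this
            have hX : X ∈ A s := by
              intro i hi
              have hia : i ≠ a := fun h => has (h ▸ hi)
              have hri := hJ i (Finset.mem_insert_of_mem hi)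
              have hfi : f i ≠ a := fun h => by
                have := hmax i hi
                rw [h] at hri
                exact absurd hri (not_lt.2 this)
              simpa [hia, hfi] using hmem i (Finset.mem_insert_of_mem hi)
            rw [Set.indicator_of_mem hy]
            simp [hg, hX, hmem]
          · simp [hg, hmem]
        calc _ ≤ ∫⁻ y, (Metric.closedBall (X (f a)) r).indicator (fun _ => g s X) y ∂ν :=
              lintegral_mono hle
          _ = g s X * ν (Metric.closedBall (X (f a)) r) := by
              rw [lintegral_indicator Metric.isClosed_closedBall.measurableSet]
              simp
          _ ≤ q * g s X := by
              rw [mul_comm]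
              gcongr
              exact hq _
      refine (lmarginal_mono h1).trans fun X => ?_
      have h2 : (∫⋯∫⁻_s, (fun X => q * g s X) ∂fun _ => ν) X =
          q * (∫⋯∫⁻_s, g s ∂fun _ => ν) X := by
        simp only [lmarginal]
        exact lintegral_const_mul _ ((hgm s).comp (by fun_prop))
      rw [h2, pow_succ, mul_comm]
      gcongr
      exact ih (fun i hi => hJ i (Finset.mem_insert_of_mem hi)) X
  have hfin := lintegral_le_of_lmarginal_le (μ := fun _ : ι => ν) J (hgm J)
    (measurable_const (a := q ^ J.card)) (by
      refine (key J hJ).trans fun X => ?_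
      simp [lmarginal])
  rw [lintegral_indicator_one (hAm J)] at hfin
  simpa using hfin

/-! ### Mean and variance of the number of links -/

section Links

variable {n : ℕ} {ν : Measure Plane} [IsProbabilityMeasure ν] {r p : ℝ}

/-- The indicator of the event that two given nodes are at distance at most `r`. -/
noncomputable def closeInd (r : ℝ) (e : Fin n × Fin n) : (Fin n → Plane) → ℝ :=
  {X : Fin n → Plane | dist (X e.1) (X e.2) ≤ r}.indicator 1

lemma measurable_closeInd (r : ℝ) (e : Fin n × Fin n) : Measurable (closeInd r e) :=
  measurable_one.indicator (measurableSet_dist_le r e.1 e.2)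

lemma memLp_closeInd (r : ℝ) (e : Fin n × Fin n) (s : ℝ≥0∞) :
    MemLp (closeInd r e) s (Measure.pi fun _ : Fin n => ν) :=
  MemLp.of_bound (measurable_closeInd r e).aestronglyMeasurable 1 <| ae_of_all _ fun X => by
    by_cases h : X ∈ {X : Fin n → Plane | dist (X e.1) (X e.2) ≤ r} <;> simp [closeInd, h]

lemma card_links_eq_sum (r : ℝ) (X : Fin n → Plane) :
    ((links r X).card : ℝ) = ∑ e ∈ (Finset.univ : Finset (Fin n)).offDiag, closeInd r e X := by
  classical
  have : links r X = {e ∈ (Finset.univ : Finset (Fin n)).offDiag | dist (X e.1) (X e.2) ≤ r} := by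
    ext e
    simp [mem_links]
  rw [this, Finset.card_filter]
  push_cast
  refine Finset.sum_congr rfl fun e _ => ?_
  by_cases h : dist (X e.1) (X e.2) ≤ r <;> simp [closeInd, h]

lemma pi_real_forall_dist_le (hp : 0 ≤ p)
    (hν : ∀ x, ν (Metric.closedBall x r) ≤ ENNReal.ofReal p) (a : Fin n) (J : Finset (Fin n))
    (hJ : a ∉ J) :
    (Measure.pi fun _ : Fin n => ν).real {X | ∀ i ∈ J, dist (X i) (X a) ≤ r} ≤ p ^ J.card := by
  classical
  refine ENNReal.toReal_le_of_le_ofReal (by positivity) ?_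
  rw [ENNReal.ofReal_pow hp]
  -- A star: all of `J` has the centre `a` as partner, so two ranks suffice.
  exact pi_forall_dist_le hν (fun _ => a) (fun i => if i ∈ J then 1 else 0) J
    fun i hi => by simp [hi, hJ]

lemma integral_closeInd_le (hp : 0 ≤ p)
    (hν : ∀ x, ν (Metric.closedBall x r) ≤ ENNReal.ofReal p) {e : Fin n × Fin n}
    (he : e.1 ≠ e.2) :
    ∫ X, closeInd r e X ∂(Measure.pi fun _ : Fin n => ν) ≤ p := by
  rw [closeInd, integral_indicator_one (measurableSet_dist_le r _ _)]
  simpa using pi_real_forall_dist_le hp hν e.2 {e.1} (by simpa using he.symm)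

lemma integral_card_links_le (hp : 0 ≤ p)
    (hν : ∀ x, ν (Metric.closedBall x r) ≤ ENNReal.ofReal p) :
    ∫ X, ((links r X).card : ℝ) ∂(Measure.pi fun _ : Fin n => ν) ≤ n ^ 2 * p := by
  simp_rw [card_links_eq_sum]
  rw [integral_finsetSum _ fun e _ => (memLp_closeInd r e 1).integrable le_rfl]
  calc _ ≤ ∑ e ∈ (Finset.univ : Finset (Fin n)).offDiag, p :=
        Finset.sum_le_sum fun e he => integral_closeInd_le hp hν (Finset.mem_offDiag.1 he).2.2
    _ ≤ _ := by
      rw [Finset.sum_const, nsmul_eq_mul]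
      gcongr
      rw [Finset.offDiag_card, Finset.card_univ, Fintype.card_fin, sq]
      exact_mod_cast Nat.sub_le _ _

/-- The covariance is at most the joint probability: p if the two links join the same pair of nodes,
in either order, and p² if they share one node, by conditioning on that node. Links without a common
node are independent. The indicators are arranged so that the bound can be summed over all pairs of
links. -/
lemma covariance_closeInd_le (hp : 0 ≤ p)
    (hν : ∀ x, ν (Metric.closedBall x r) ≤ ENNReal.ofReal p) {a b c d : Fin n}
    (hab : a ≠ b) (hcd : c ≠ d) :
    cov[closeInd r (a, b), closeInd r (c, d); Measure.pi fun _ : Fin n => ν] ≤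
      p * ((if a = c ∧ b = d then 1 else 0) + (if a = d ∧ b = c then 1 else 0)) +
      p ^ 2 * ((if a = c then 1 else 0) + (if a = d then 1 else 0) + (if b = c then 1 else 0) +
        (if b = d then 1 else 0)) := by
  classical
  have hint : ∀ e : Fin n × Fin n,
      0 ≤ ∫ X, closeInd r e X ∂(Measure.pi fun _ : Fin n => ν) := fun e =>
    integral_nonneg fun X => Set.indicator_nonneg (by simp) X
  have hcov : cov[closeInd r (a, b), closeInd r (c, d); Measure.pi fun _ : Fin n => ν] ≤
      (Measure.pi fun _ : Fin n => ν).real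
        {X | dist (X a) (X b) ≤ r ∧ dist (X c) (X d) ≤ r} := by
    rw [covariance_eq_sub (memLp_closeInd r _ 2) (memLp_closeInd r _ 2)]
    have hmul : closeInd r (a, b) * closeInd r (c, d) =
        {X : Fin n → Plane | dist (X a) (X b) ≤ r ∧ dist (X c) (X d) ≤ r}.indicator 1 := by
      rw [closeInd, closeInd, ← Set.inter_indicator_one]
      rfl
    have hset : MeasurableSet
        {X : Fin n → Plane | dist (X a) (X b) ≤ r ∧ dist (X c) (X d) ≤ r} :=
      (measurableSet_dist_le r a b).inter (measurableSet_dist_le r c d)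
    rw [hmul, integral_indicator_one hset]
    have := mul_nonneg (hint (a, b)) (hint (c, d))
    linarith
  have hpair : ∀ x y z : Fin n, x ≠ y → x ≠ z → y ≠ z → ∀ P : (Fin n → Plane) → Prop,
      (∀ X, P X → dist (X y) (X x) ≤ r ∧ dist (X z) (X x) ≤ r) →
      (Measure.pi fun _ : Fin n => ν).real {X | P X} ≤ p ^ 2 := by
    intro x y z hxy hxz hyz P hP
    have := pi_real_forall_dist_le hp hν x {y, z} (by simp [hxy, hxz])
    rw [Finset.card_pair hyz] at this
    refine (measureReal_mono fun X hX => ?_).trans this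
    simpa using hP X hX
  have hsq := sq_nonneg p
  by_cases hac : a = c
  · subst hac
    by_cases hbd : b = d
    · subst hbd
      have h1 := pi_real_forall_dist_le hp hν b {a} (by simpa using hab.symm)
      have h2 : (Measure.pi fun _ : Fin n => ν).real
          {X | dist (X a) (X b) ≤ r ∧ dist (X a) (X b) ≤ r} ≤ p := by simpa using h1
      simp [hab, hab.symm]
      nlinarith
    · have := hpair a b d hab hcd hbd _ (fun X (hX : dist (X a) (X b) ≤ r ∧
        dist (X a) (X d) ≤ r) => ⟨by rw [dist_comm]; exact hX.1, by rw [dist_comm]; exact hX.2⟩)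
      simp [hab.symm, hbd, hcd]
      linarith
  · by_cases had : a = d
    · subst had
      by_cases hbc : b = c
      · subst hbc
        have h1 := pi_real_forall_dist_le hp hν b {a} (by simpa using hab.symm)
        have h2 : (Measure.pi fun _ : Fin n => ν).real
            {X | dist (X a) (X b) ≤ r ∧ dist (X b) (X a) ≤ r} ≤ p := by
          refine (measureReal_mono fun X hX => ?_).trans (h1.trans_eq (by simp))
          simpa using hX.1
        simp [hab, hab.symm]
        nlinarith
      · have := hpair a b c hab hcd.symm hbc _ (fun X (hX : dist (X a) (X b) ≤ r ∧
          dist (X c) (X a) ≤ r) => ⟨by rw [dist_comm]; exact hX.1, hX.2⟩)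
        simp [hab.symm, hac, hbc]
        linarith
    · by_cases hbc : b = c
      · subst hbc
        have := hpair b a d hab.symm hcd had _ (fun X (hX : dist (X a) (X b) ≤ r ∧
          dist (X b) (X d) ≤ r) => ⟨hX.1, by rw [dist_comm]; exact hX.2⟩)
        simp [hab, had, hcd]
        linarith
      · by_cases hbd : b = d
        · subst hbd
          have := hpair b a c hab.symm hcd.symm hac _ (fun X (hX : dist (X a) (X b) ≤ r ∧
            dist (X c) (X b) ≤ r) => hX)
          simp [hab, hac, hbc]
          linarith
        · have hi : IndepFun (closeInd r (a, b)) (closeInd r (c, d))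
              (Measure.pi fun _ : Fin n => ν) := by
            have h0 := (iIndepFun_pi (μ := fun _ : Fin n => ν) (X := fun _ => id)
              fun _ => aemeasurable_id).indepFun_prodMk_prodMk
              (fun i => measurable_pi_apply i) a b c d hac had hbc hbd
            have hm : Measurable ({z : Plane × Plane | dist z.1 z.2 ≤ r}.indicator
                (1 : Plane × Plane → ℝ)) :=
              measurable_one.indicator
                (measurableSet_le (measurable_fst.dist measurable_snd) measurable_const)
            exact h0.comp hm hm
          rw [hi.covariance_eq_zero (memLp_closeInd r _ 2) (memLp_closeInd r _ 2)]
          simp [hac, had, hbc, hbd]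

lemma variance_card_links_le (hp : 0 ≤ p)
    (hν : ∀ x, ν (Metric.closedBall x r) ≤ ENNReal.ofReal p) :
    Var[fun X => ((links r X).card : ℝ); Measure.pi fun _ : Fin n => ν] ≤
      2 * n ^ 2 * p + 4 * n ^ 3 * p ^ 2 := by
  classical
  simp_rw [card_links_eq_sum]
  rw [variance_fun_sum' fun e _ => memLp_closeInd r e 2]
  set b : Fin n × Fin n → Fin n × Fin n → ℝ := fun e e' =>
    p * ((if e.1 = e'.1 ∧ e.2 = e'.2 then 1 else 0) +
      (if e.1 = e'.2 ∧ e.2 = e'.1 then 1 else 0)) +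
      p ^ 2 * ((if e.1 = e'.1 then 1 else 0) + (if e.1 = e'.2 then 1 else 0) +
        (if e.2 = e'.1 then 1 else 0) + (if e.2 = e'.2 then 1 else 0)) with hb
  have hind : ∀ P : Prop, [Decidable P] → (0 : ℝ) ≤ if P then 1 else 0 := fun P _ => by
    split_ifs <;> norm_num
  have hb0 : ∀ e e', 0 ≤ b e e' := fun e e' => by
    exact add_nonneg (mul_nonneg hp (add_nonneg (hind _) (hind _)))
      (mul_nonneg (sq_nonneg p)
        (add_nonneg (add_nonneg (add_nonneg (hind _) (hind _)) (hind _)) (hind _)))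
  calc _ ≤ ∑ e ∈ (Finset.univ : Finset (Fin n)).offDiag,
        ∑ e' ∈ (Finset.univ : Finset (Fin n)).offDiag, b e e' :=
        Finset.sum_le_sum fun e he => Finset.sum_le_sum fun e' he' =>
          covariance_closeInd_le hp hν (Finset.mem_offDiag.1 he).2.2
            (Finset.mem_offDiag.1 he').2.2
    _ ≤ ∑ e, ∑ e', b e e' := by
      refine (Finset.sum_le_sum fun e _ => Finset.sum_le_univ_sum_of_nonneg (hb0 e)).trans ?_
      exact Finset.sum_le_univ_sum_of_nonneg fun e => Finset.sum_nonneg fun e' _ => hb0 e e'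
    _ = 2 * n ^ 2 * p + 4 * n ^ 3 * p ^ 2 := by
      simp only [hb, Fintype.sum_prod_type, Finset.sum_add_distrib, ← Finset.mul_sum, ite_and,
        Finset.sum_ite_eq, Finset.mem_univ, if_true, Finset.sum_const, Finset.card_univ,
        Fintype.card_fin, nsmul_eq_mul]
      simp [apply_ite Finset.card, apply_ite (Nat.cast (R := ℝ))]
      ring

lemma memLp_card_links (s : ℝ≥0∞) :
    MemLp (fun X => ((links r X).card : ℝ)) s (Measure.pi fun _ : Fin n => ν) := by
  simp_rw [card_links_eq_sum]
  exact memLp_finsetSum _ fun e _ => memLp_closeInd r e s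

/-- First moment bound: with few links some node is isolated. -/
lemma pi_le_card_links_le (hn : 0 < n) (hp : 0 ≤ p)
    (hν : ∀ x, ν (Metric.closedBall x r) ≤ ENNReal.ofReal p) :
    (Measure.pi fun _ : Fin n => ν).real {X | n ≤ (links r X).card} ≤ n * p := by
  have hn' : (0 : ℝ) < n := by exact_mod_cast hn
  have h := mul_meas_ge_le_integral_of_nonneg (μ := Measure.pi fun _ : Fin n => ν)
    (ae_of_all _ fun X => Nat.cast_nonneg (links r X).card)
    ((memLp_card_links (r := r) (ν := ν) 1).integrable le_rfl) (n : ℝ)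
  have h2 := h.trans (integral_card_links_le hp hν)
  simp only [Nat.cast_le] at h2
  rw [sq, mul_assoc] at h2
  exact le_of_mul_le_mul_left h2 hn'

/-- Second moment bound: the number of links exceeds twice the bound on its mean rarely. -/
lemma pi_two_mul_le_card_links_le (hn : 0 < n) (hp : 0 < p)
    (hν : ∀ x, ν (Metric.closedBall x r) ≤ ENNReal.ofReal p) :
    (Measure.pi fun _ : Fin n => ν).real {X | 2 * (n ^ 2 * p) ≤ (links r X).card} ≤
      4 / n + 2 / (n ^ 2 * p) := by
  have hn' : (0 : ℝ) < n := by exact_mod_cast hn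
  have hc : 0 < (n : ℝ) ^ 2 * p := by positivity
  -- The mean is at most n²p, so reaching 2n²p is a deviation of at least n²p.
  have h := meas_ge_le_variance_div_sq (memLp_card_links (r := r) (ν := ν) (n := n) 2) hc
  refine ENNReal.toReal_le_of_le_ofReal (by positivity) ((measure_mono fun X hX => ?_).trans
    (h.trans (ENNReal.ofReal_le_ofReal ?_)))
  · have h1 := integral_card_links_le (n := n) hp.le hν
    simp only [Set.mem_ofPred_eq] at hX ⊢
    exact le_trans (by linarith) (le_abs_self _)
  · rw [div_le_iff₀ (by positivity)]
    refine (variance_card_links_le hp.le hν).trans_eq ?_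
    field_simp
    ring

end Links

/-! ### Uniform points in the square and their distances to partners -/

lemma volume_unitSquare : (volume : Measure Plane) unitSquare = 1 := by
  have h : unitSquare = (WithLp.ofLp : Plane → Fin 2 → ℝ) ⁻¹'
      Set.univ.pi fun _ => Set.Icc (0 : ℝ) 1 := by
    ext x
    simp only [unitSquare, Set.mem_ofPred_eq, Set.mem_preimage, Set.mem_univ_pi]
  rw [h, (PiLp.volume_preserving_ofLp (Fin 2)).measure_preimage
    (MeasurableSet.univ_pi fun _ => measurableSet_Icc).nullMeasurableSet, volume_pi_pi]
  simp

instance isProbabilityMeasure_restrict_unitSquare :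
    IsProbabilityMeasure ((volume : Measure Plane).restrict unitSquare) :=
  ⟨by rw [Measure.restrict_apply_univ, volume_unitSquare]⟩

lemma restrict_unitSquare_closedBall_le {r : ℝ} (hr : 0 ≤ r) (x : Plane) :
    (volume : Measure Plane).restrict unitSquare (Metric.closedBall x r) ≤
      ENNReal.ofReal (4 * r ^ 2) := by
  refine (Measure.restrict_apply_le _ _).trans ?_
  rw [EuclideanSpace.volume_closedBall_fin_two, ← ENNReal.ofReal_pow hr,
    ← ENNReal.ofReal_mul (by positivity), mul_comm]
  exact ENNReal.ofReal_le_ofReal (mul_le_mul_of_nonneg_right Real.pi_le_four (sq_nonneg r))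

open scoped Classical in
/-- The nodes that are within distance `r` of their partner under `f`. -/
noncomputable def closeTo {n : ℕ} (f : Fin n → Fin n) (r : ℝ) (X : Fin n → Plane) :
    Finset (Fin n) :=
  Finset.univ.filter fun i => dist (X i) (X (f i)) ≤ r

/-- Whatever the choice of one partner for each node, most nodes are far from their partner. -/
lemma pi_half_lt_card_closeTo_le {n : ℕ} {f : Fin n → Fin n} (hf : ∀ i, f i ≠ i)
    {ν : Measure Plane} [IsProbabilityMeasure ν] {r : ℝ}
    (hν : ∀ x, ν (Metric.closedBall x r) ≤ ENNReal.ofReal (1 / 256)) :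
    Measure.pi (fun _ : Fin n => ν) {X | n < 2 * (closeTo f r X).card} ≤
      ENNReal.ofReal ((1 / 2) ^ n) := by
  classical
  -- Since `f` may have cycles, close nodes are split by whether `f` lowers or raises the index.
  -- More than n/2 close nodes leave at least n/4 on one side, where the index or its negative
  -- serves as rank.
  set 𝒥 : Finset (Finset (Fin n)) := Finset.univ.filter fun J =>
    n ≤ 4 * J.card ∧ ((∀ i ∈ J, f i < i) ∨ ∀ i ∈ J, i < f i) with h𝒥
  have hcover : {X : Fin n → Plane | n < 2 * (closeTo f r X).card} ⊆
      ⋃ J ∈ 𝒥, {X | ∀ i ∈ J, dist (X i) (X (f i)) ≤ r} := by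
    intro X hX
    simp only [Set.mem_ofPred_eq] at hX
    have hsplit := Finset.card_filter_add_card_filter_not (s := closeTo f r X)
      (fun i => f i < i)
    have hclose : ∀ i ∈ closeTo f r X, dist (X i) (X (f i)) ≤ r := fun i hi => by
      simpa [closeTo] using hi
    simp only [Set.mem_iUnion, h𝒥, Finset.mem_filter, Finset.mem_univ, true_and]
    rcases le_total ((closeTo f r X).filter fun i => ¬ f i < i).card
      ((closeTo f r X).filter fun i => f i < i).card with h | h
    · exact ⟨_, ⟨by omega, Or.inl fun i hi => (Finset.mem_filter.1 hi).2⟩,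
        fun i hi => hclose i (Finset.mem_filter.1 hi).1⟩
    · exact ⟨_, ⟨by omega, Or.inr fun i hi =>
        lt_of_le_of_ne (not_lt.1 (Finset.mem_filter.1 hi).2) (hf i).symm⟩,
        fun i hi => hclose i (Finset.mem_filter.1 hi).1⟩
  have hone : ∀ J ∈ 𝒥, Measure.pi (fun _ : Fin n => ν)
      {X | ∀ i ∈ J, dist (X i) (X (f i)) ≤ r} ≤ ENNReal.ofReal ((1 / 4) ^ n) := by
    intro J hJ
    obtain ⟨hcard, hord⟩ := (Finset.mem_filter.1 hJ).2
    have hle : Measure.pi (fun _ : Fin n => ν) {X | ∀ i ∈ J, dist (X i) (X (f i)) ≤ r} ≤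
        ENNReal.ofReal (1 / 256) ^ J.card := by
      rcases hord with h | h
      · exact pi_forall_dist_le hν f (fun i => (i : ℤ)) J fun i hi => by
          simpa using h i hi
      · exact pi_forall_dist_le hν f (fun i => -(i : ℤ)) J fun i hi => by
          simpa using h i hi
    refine hle.trans ?_
    rw [← ENNReal.ofReal_pow (by norm_num)]
    refine ENNReal.ofReal_le_ofReal ?_
    -- With at least n/4 close pairs, 256 = 4⁴ gives (1/4)^n, which beats the 2^n choices of `J` in
    -- the union bound.
    rw [show (1 / 256 : ℝ) = (1 / 4) ^ 4 by norm_num, ← pow_mul]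
    exact pow_le_pow_of_le_one (by norm_num) (by norm_num) hcard
  calc _ ≤ ∑ J ∈ 𝒥, Measure.pi (fun _ : Fin n => ν)
        {X | ∀ i ∈ J, dist (X i) (X (f i)) ≤ r} :=
        (measure_mono hcover).trans (measure_biUnion_finset_le _ _)
    _ ≤ ∑ J ∈ 𝒥, ENNReal.ofReal ((1 / 4) ^ n) := Finset.sum_le_sum hone
    _ ≤ (2 ^ n : ℝ≥0∞) * ENNReal.ofReal ((1 / 4) ^ n) := by
      rw [Finset.sum_const, nsmul_eq_mul]
      gcongr
      have : 𝒥.card ≤ 2 ^ n := (Finset.card_le_univ _).trans (by simp)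
      exact_mod_cast this
    _ = ENNReal.ofReal ((1 / 2) ^ n) := by
      rw [show (2 ^ n : ℝ≥0∞) = ENNReal.ofReal (2 ^ n) by
        rw [ENNReal.ofReal_pow (by norm_num)]; simp, ← ENNReal.ofReal_mul (by positivity),
        ← mul_pow]
      norm_num

lemma le_sum_dist {n : ℕ} {f : Fin n → Fin n} {r : ℝ} (hr : 0 ≤ r) {X : Fin n → Plane}
    (h : 2 * (closeTo f r X).card ≤ n) : n / 2 * r ≤ ∑ i, dist (X i) (X (f i)) := by
  classical
  have hcard := Finset.card_compl_add_card (closeTo f r X)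
  rw [Fintype.card_fin] at hcard
  have hfar : (n : ℝ) / 2 ≤ ((closeTo f r X)ᶜ.card : ℝ) := by
    rw [div_le_iff₀ (by norm_num)]
    exact_mod_cast (by omega : n ≤ (closeTo f r X)ᶜ.card * 2)
  calc n / 2 * r ≤ ∑ _i ∈ (closeTo f r X)ᶜ, r := by
        rw [Finset.sum_const, nsmul_eq_mul]
        gcongr
    _ ≤ ∑ i ∈ (closeTo f r X)ᶜ, dist (X i) (X (f i)) := Finset.sum_le_sum fun i hi => by
        have : r < dist (X i) (X (f i)) := by simpa [closeTo] using hi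
        exact this.le
    _ ≤ _ := Finset.sum_le_univ_sum_of_nonneg fun i => dist_nonneg

/-! ### Assembling the bounds -/

/-- The bound on the probability of feasibility for given destination sets. -/
lemma pi_feasible_le {n m : ℕ} (hn : 0 < n) (hm : 1 ≤ m) {W Δ T : ℝ} (hW : 0 < W) (hT : 0 < T)
    {D : Fin n → Finset (Fin n)} (hD : D ∈ assignments n m) :
    Measure.pi (fun _ : Fin n => (volume : Measure Plane).restrict unitSquare)
      {X | Feasible W Δ T X D (512 * W * (n * T ^ 3))} ≤
      ENNReal.ofReal ((1 / 2) ^ n + (4 / n + 2 / √n)) := by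
  set μ := Measure.pi (fun _ : Fin n => (volume : Measure Plane).restrict unitSquare)
  have hn' : (0 : ℝ) < n := by exact_mod_cast hn
  have hne : ∀ i, (D i).Nonempty := fun i => Finset.card_pos.1 (by rw [(hD i).1]; omega)
  choose f hf using hne
  have hfi : ∀ i, f i ≠ i := fun i h => (hD i).2 (by simpa only [h] using hf i)
  have hp : 0 < 4 * T ^ 2 := by positivity
  have hball := restrict_unitSquare_closedBall_le hT.le
  have hsub : {X | Feasible W Δ T X D (512 * W * (n * T ^ 3))} ⊆
      {X | n < 2 * (closeTo f (1 / 32) X).card} ∪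
        ({X | n ≤ (links T X).card} ∩
          {X | 2 * ((n : ℝ) ^ 2 * (4 * T ^ 2)) ≤ (links T X).card}) := by
    intro X hX
    by_cases hclose : n < 2 * (closeTo f (1 / 32) X).card
    · exact Or.inl hclose
    · refine Or.inr ⟨hX.le_card_links hW (by positivity) fun i => ⟨f i, hf i⟩, ?_⟩
      have h1 := hX.rate_mul_sum_dist_le hW hT.le hf
      have h2 := le_sum_dist (by norm_num) (not_lt.1 hclose)
      have h3 : W * T * (2 * (n ^ 2 * (4 * T ^ 2))) ≤ W * T * (links T X).card := by
        -- The constant 512 is fixed here: 512 · (1/2) · (1/32) = 8 = 2 · 4.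
        refine le_trans ?_ ((mul_le_mul_of_nonneg_left h2 (by positivity)).trans h1)
        apply le_of_eq
        ring
      exact le_of_mul_le_mul_left h3 (by positivity)
  have hlinks : μ ({X | n ≤ (links T X).card} ∩
      {X | 2 * ((n : ℝ) ^ 2 * (4 * T ^ 2)) ≤ (links T X).card}) ≤
      ENNReal.ofReal (4 / n + 2 / √n) := by
    rw [← ofReal_measureReal]
    refine ENNReal.ofReal_le_ofReal ?_
    have hsqrt : 0 < √(n : ℝ) := Real.sqrt_pos.2 hn'
    have hpos : (0 : ℝ) ≤ 4 / n := by positivity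
    -- At this threshold the Markov bound np is at most 1/√n on one side, and n²p ≥ √n in the
    -- Chebyshev bound on the other.
    by_cases hsmall : n * (4 * T ^ 2) ≤ 1 / √n
    · refine (measureReal_mono Set.inter_subset_left).trans
        ((pi_le_card_links_le hn hp.le hball).trans (hsmall.trans ?_))
      have : 1 / √(n : ℝ) ≤ 2 / √n := by gcongr; norm_num
      linarith
    · refine (measureReal_mono Set.inter_subset_right).trans
        ((pi_two_mul_le_card_links_le hn hp hball).trans ?_)
      gcongr
      calc √(n : ℝ) = n * (1 / √n) := by
            field_simp
            exact Real.sq_sqrt hn'.le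
        _ ≤ n * (n * (4 * T ^ 2)) := by
            gcongr
            exact (not_le.1 hsmall).le
        _ = _ := by ring
  rw [ENNReal.ofReal_add (by positivity) (by positivity)]
  refine (measure_mono hsub).trans ((measure_union_le _ _).trans (add_le_add ?_ hlinks))
  exact pi_half_lt_card_closeTo_le hfi fun x =>
    (restrict_unitSquare_closedBall_le (by norm_num) x).trans_eq (by norm_num)

/-- A bound that is valid for all assignments of destinations is valid in the random network. -/
lemma networkLaw_le {n m : ℕ} {P : (Fin n → Plane) → (Fin n → Finset (Fin n)) → Prop} {ε : ℝ≥0∞}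
    (h : ∀ D ∈ assignments n m,
      Measure.pi (fun _ : Fin n => (volume : Measure Plane).restrict unitSquare)
        {X | P X D} ≤ ε) :
    networkLaw n m {ω | P ω.1 ω.2} ≤ ε := by
  classical
  -- Slicing over the finitely many `D` gives rectangles, whose product measure needs no
  -- measurability of the event.
  have hsub : {ω : (Fin n → Plane) × (Fin n → Finset (Fin n)) | P ω.1 ω.2} ⊆
      ⋃ D ∈ (Finset.univ : Finset (Fin n → Finset (Fin n))), {X | P X D} ×ˢ {D} := by
    rintro ⟨X, D⟩ hω
    simpa using hω
  calc networkLaw n m {ω | P ω.1 ω.2}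
      ≤ ∑ D, networkLaw n m ({X | P X D} ×ˢ {D}) :=
        (measure_mono hsub).trans (measure_biUnion_finset_le _ _)
    _ ≤ ∑ D, ε * uniformOn (assignments n m) {D} := by
      refine Finset.sum_le_sum fun D _ => ?_
      rw [networkLaw, Measure.prod_prod]
      by_cases hD : D ∈ assignments n m
      · gcongr
        exact h D hD
      · have : uniformOn (assignments n m) {D} = 0 := by
          rw [uniformOn_eq_zero_iff (Set.toFinite _)]
          simpa using hD
        simp [this]
    _ ≤ ε := by
      rw [← Finset.mul_sum, sum_measure_singleton]
      -- If there are no assignments, `uniformOn` is the zero measure and the mass bound still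
      -- holds.
      exact mul_le_of_le_one_right' prob_le_one

end Multicast

theorem theorem4p4 (m : ℕ) (hm : 1 ≤ m) (W : ℝ) (hW : 0 < W) (Δ : ℝ) (hΔ : 0 ≤ Δ) :
    ∃ c : ℝ, 0 < c ∧ ∀ T : ℕ → ℝ, (∀ n, 0 < T n) →
      Tendsto (fun n : ℕ => Multicast.feasibleProb n m W Δ (T n) (c * (n * T n ^ 3))) atTop (𝓝 0) := by
  refine ⟨512 * W, by positivity, fun T hT => ?_⟩
  have hlim : Tendsto (fun n : ℕ => (1 / 2 : ℝ) ^ n + (4 / n + 2 / √(n : ℝ))) atTop (𝓝 0) := by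
    have h1 : Tendsto (fun n : ℕ => (1 / 2 : ℝ) ^ n) atTop (𝓝 0) :=
      tendsto_pow_atTop_nhds_zero_of_lt_one (by norm_num) (by norm_num)
    have h2 : Tendsto (fun n : ℕ => (4 : ℝ) / n) atTop (𝓝 0) :=
      tendsto_const_div_atTop_nhds_zero_nat 4
    have h3 : Tendsto (fun n : ℕ => 2 / √(n : ℝ)) atTop (𝓝 0) :=
      (Real.tendsto_sqrt_atTop.comp tendsto_natCast_atTop_atTop).const_div_atTop 2
    simpa using h1.add (h2.add h3)
  have hlim' := ENNReal.tendsto_ofReal hlim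
  rw [ENNReal.ofReal_zero] at hlim'
  refine tendsto_of_tendsto_of_tendsto_of_le_of_le' tendsto_const_nhds hlim'
    (Eventually.of_forall fun _ => zero_le) ?_
  filter_upwards [eventually_gt_atTop 0] with n hn
  exact Multicast.networkLaw_le fun D hD => Multicast.pi_feasible_le hn hm hW (hT n) hD
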